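/- For $n\in\mathbb N$, $n\ge 1$, and $1\le p<\infty$ let $\|x\|_p=\big(\sum_{i=1}^n|x_i|^p\big)^{1/p}$ for $x\in\mathbb R^n$, let $\mathbb B_p^n=\{x\in\mathbb R^n:\|x\|_p\le 1\}$ and $\mathbb S_p^{n-1}=\{x\in\mathbb R^n:\|x\|_p=1\}$, and let $\mathbf M_{\mathbb B_p^n}$ be the cone probability measure of $\mathbb B_p^n$, that is, the Borel probability measure on $\mathbb S_p^{n-1}$ given by \[ \mathbf M_{\mathbb B_p^n}(B)=\frac{\mathrm{vol}_n\big(\{rx:x\in B,\ 0\le r\le 1\}\big)}{\mathrm{vol}_n(\mathbb B_p^n)},\qquad B\subseteq\mathbb S_p^{n-1}\text{ Borel}. \] For a measurable function $f:\mathbb S_p^{n-1}\to\mathbb R$ let \[ \|f\|_{\psi_2}=\inf\Big\{\lambda>0:\int_{\mathbb S_p^{n-1}}\Big(e^{|f|^2/\lambda^2}-1\Big)\,d\mathbf M_{\mathbb B_p^n}\le 1\Big\} \] (with $\inf\emptyset=\infty$) be its Luxemburg norm with respect to the Orlicz function $\psi_2(x)=e^{x^2}-1$. There exists an absolute constant $c\in(0,\infty)$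 such that, for every $n\ge1$, every $1\le p<2$ and every $\theta\in\mathbb R^n$ with $\|\theta\|_\infty=\max_{1\le i\le n}|\theta_i|=1$, \[ \Big\|\frac{1}{n^{1/2-1/p}}\langle\,\cdot\,,\theta\rangle\Big\|_{\psi_2}\le c . \] -/

import Mathlib

open MeasureTheory Set
open scoped ENNReal

namespace ConeMeasure

/-- The `ℓ_p` norm on `ℝⁿ` (for `1 ≤ p < ∞`). -/
noncomputable def pNorm {n : ℕ} (p : ℝ) (x : Fin n → ℝ) : ℝ :=
  (∑ i, |x i| ^ p) ^ (1 / p)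

/-- The unit ball of `ℓ_p^n`. -/
def pBall (n : ℕ) (p : ℝ) : Set (Fin n → ℝ) := {x | pNorm p x ≤ 1}

/-- The unit sphere of `ℓ_p^n`. -/
def pSphere (n : ℕ) (p : ℝ) : Set (Fin n → ℝ) := {x | pNorm p x = 1}

/-- The set `{r x : x ∈ B, 0 ≤ r ≤ 1}`. -/
def cone {n : ℕ} (B : Set (Fin n → ℝ)) : Set (Fin n → ℝ) :=
  {y | ∃ x ∈ B, ∃ r : ℝ, 0 ≤ r ∧ r ≤ 1 ∧ y = r • x}

theorem pNorm_smul {n : ℕ} {p : ℝ} (hp : 1 ≤ p) {r : ℝ} (hr : 0 ≤ r) (x : Fin n → ℝ) :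
    pNorm p (r • x) = r * pNorm p x := by
  have hp0 : p ≠ 0 := by linarith
  have h : ∑ i, |(r • x) i| ^ p = r ^ p * ∑ i, |x i| ^ p := by
    rw [Finset.mul_sum]
    refine Finset.sum_congr rfl fun i _ => ?_
    rw [Pi.smul_apply, smul_eq_mul, abs_mul, abs_of_nonneg hr,
      Real.mul_rpow hr (abs_nonneg _)]
  unfold pNorm
  rw [h, Real.mul_rpow (Real.rpow_nonneg hr _)
    (Finset.sum_nonneg fun i _ => Real.rpow_nonneg (abs_nonneg _) _),
    ← Real.rpow_mul hr, mul_one_div_cancel hp0, Real.rpow_one]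

theorem measurable_pNorm {n : ℕ} (p : ℝ) :
    Measurable (fun x : Fin n → ℝ => pNorm p x) := by
  unfold pNorm
  fun_prop

theorem measurableSet_pSphere (n : ℕ) (p : ℝ) : MeasurableSet (pSphere n p) :=
  measurable_pNorm p (measurableSet_singleton 1)

theorem cone_iUnion {n : ℕ} (B : ℕ → Set (Fin n → ℝ)) :
    cone (⋃ i, B i) = ⋃ i, cone (B i) := by
  ext y
  simp only [cone, mem_ofPred_eq, mem_iUnion]
  constructor
  · rintro ⟨x, ⟨i, hi⟩, h⟩
    exact ⟨i, x, hi, h⟩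
  · rintro ⟨i, x, hi, h⟩
    exact ⟨x, ⟨i, hi⟩, h⟩

theorem cone_diff_zero {n : ℕ} {p : ℝ} (hp : 1 ≤ p) {B : Set (Fin n → ℝ)}
    (hB : B ⊆ pSphere n p) :
    cone B \ {0} = {y | 0 < pNorm p y ∧ pNorm p y ≤ 1 ∧ (pNorm p y)⁻¹ • y ∈ B} := by
  ext y
  constructor
  · rintro ⟨⟨x, hx, r, hr0, hr1, rfl⟩, hy⟩
    have hr : r ≠ 0 := by
      rintro rfl
      exact hy (by simp)
    have hx1 : pNorm p x = 1 := hB hx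
    have h1 : pNorm p (r • x) = r := by rw [pNorm_smul hp hr0, hx1, mul_one]
    refine ⟨?_, ?_, ?_⟩
    · rw [h1]
      exact lt_of_le_of_ne hr0 hr.symm
    · rw [h1]
      exact hr1
    · rw [h1, smul_smul, inv_mul_cancel₀ hr, one_smul]
      exact hx
  · rintro ⟨h0, h1, hy⟩
    refine ⟨⟨_, hy, pNorm p y, h0.le, h1, ?_⟩, ?_⟩
    · rw [smul_smul, mul_inv_cancel₀ h0.ne', one_smul]
    · rintro rfl
      have h : pNorm p (0 : Fin n → ℝ) = 0 := by
        simpa using pNorm_smul hp le_rfl (0 : Fin n → ℝ)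
      exact h0.ne' h

theorem measurableSet_cone {n : ℕ} {p : ℝ} (hp : 1 ≤ p) {B : Set (Fin n → ℝ)}
    (hB : B ⊆ pSphere n p) (hm : MeasurableSet B) : MeasurableSet (cone B) := by
  have hd : MeasurableSet (cone B \ {0}) := by
    rw [cone_diff_zero hp hB]
    have hN := measurable_pNorm (n := n) p
    exact (measurableSet_lt measurable_const hN).inter
      ((measurableSet_le hN measurable_const).inter ((hN.inv.smul measurable_id) hm))
  by_cases h : (0 : Fin n → ℝ) ∈ cone B
  · have : cone B = (cone B \ {0}) ∪ {0} := by
      rw [sdiff_union_self, union_eq_self_of_subset_right (singleton_subset_iff.2 h)]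
    rw [this]
    exact hd.union (measurableSet_singleton 0)
  · rwa [sdiff_singleton_eq_self h] at hd

theorem aedisjoint_cone {n : ℕ} {p : ℝ} (hp : 1 ≤ p) {A B : Set (Fin n → ℝ)}
    (hA : A ⊆ pSphere n p) (hB : B ⊆ pSphere n p) (hAB : Disjoint A B) :
    AEDisjoint volume (cone A) (cone B) := by
  have hsub : cone A ∩ cone B ⊆ {0} := by
    rintro y ⟨h1, h2⟩
    by_contra hy
    have a : y ∈ cone A \ {0} := ⟨h1, hy⟩
    have b : y ∈ cone B \ {0} := ⟨h2, hy⟩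
    rw [cone_diff_zero hp hA] at a
    rw [cone_diff_zero hp hB] at b
    exact Set.disjoint_left.1 hAB a.2.2 b.2.2
  rcases Nat.eq_zero_or_pos n with rfl | hn
  · have hA0 : A = ∅ := by
      refine eq_empty_iff_forall_notMem.2 fun x hx => ?_
      have h := hA hx
      have h0 : (1 / p : ℝ) ≠ 0 := by positivity
      simp [pSphere, pNorm] at h
      rw [Real.zero_rpow (by positivity)] at h
      exact zero_ne_one h
    have : cone A = ∅ := by
      rw [hA0]
      ext y
      simp [cone]
    simp [AEDisjoint, this]
  · have : Nonempty (Fin n) := ⟨⟨0, hn⟩⟩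
    exact measure_mono_null hsub (measure_singleton 0)

/-- The cone probability measure of the unit ball of `ℓ_p^n`, a Borel measure on the unit
sphere: the measure of `B` is `vol {r x : x ∈ B, 0 ≤ r ≤ 1} / vol (ball)`. -/
noncomputable def coneMeasure (n : ℕ) (p : ℝ) (hp : 1 ≤ p) : Measure (pSphere n p) :=
  Measure.ofMeasurable
    (fun B _ => volume (cone (Subtype.val '' B)) / volume (pBall n p))
    (by simp [cone])
    (by
      intro B hB hd
      have hS : ∀ i, (Subtype.val '' B i : Set (Fin n → ℝ)) ⊆ pSphere n p := by
        rintro i _ ⟨x, _, rfl⟩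
        exact x.2
      have h : volume (cone (⋃ i, (Subtype.val '' B i : Set (Fin n → ℝ))))
          = ∑' i, volume (cone (Subtype.val '' B i : Set (Fin n → ℝ))) := by
        rw [cone_iUnion]
        refine measure_iUnion₀ (fun i j hij => ?_) (fun i => ?_)
        · exact aedisjoint_cone hp (hS i) (hS j)
            ((disjoint_image_iff Subtype.val_injective).2 (hd hij))
        · exact (measurableSet_cone hp (hS i)
            ((measurableSet_pSphere n p).subtype_image (hB i))).nullMeasurableSet
      simp only [image_iUnion]
      rw [h]
      simp only [div_eq_mul_inv]
      rw [ENNReal.tsum_mul_right])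

/-- The Orlicz function `ψ₂`. -/
noncomputable def psi2 (x : ℝ) : ℝ := Real.exp (x ^ 2) - 1

/-- The Luxemburg norm of `f` for the Orlicz function `M`. It is extended-valued: it is `∞`
exactly when no `t > 0` has `∫ M(|f| / t) dμ ≤ 1`. -/
noncomputable def luxemburgNorm {Ω : Type*} [MeasurableSpace Ω] (M : ℝ → ℝ) (μ : Measure Ω)
    (f : Ω → ℝ) : ℝ≥0∞ :=
  sInf {s | ∃ t : ℝ, 0 < t ∧ s = ENNReal.ofReal t ∧
    ∫⁻ ω, ENNReal.ofReal (M (|f ω| / t)) ∂μ ≤ 1}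

end ConeMeasure

/-! Compare the cone measure with the product measure of density `e^{-‖x‖_p^p}` on `ℝⁿ`. In polar
coordinates for `‖·‖_p`, direction and radius separate under this density, and the direction follows
the cone measure (`lintegral_radialProj_mul`). As `⟨x,θ⟩^{2k}` is homogeneous, its cone moment is
the Gaussian-type moment `E⟨G,θ⟩^{2k}` divided by `E‖G‖_p^{2k}`.

The numerator is bounded through exponential moments: the coordinates of `G` are independent,
symmetric and subexponential uniformly in `p`, so `E e^{s⟨G,θ⟩} ≤ e^{300 s² n}` for `|s| ≤ 1/4`
(`lintegral_exp_inner_le`). The denominator is at least `(n e^{-7})^{2k/p}` by Jensen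
(`le_lintegral_pNorm_pow`). With `s² = k/(16n)`, the normalised form has `2k`-th moment at most
`(Dk)^k` for `k ≤ n`.

For `k ≥ n` that `s` may be too large, but Hölder bounds the square of the normalised form by `n ≤
k` pointwise (`sq_normalized_inner_le`). Moments of size `(Dk)^k` make the exponential series
converge, which is the `ψ₂` bound (`lintegral_psi2_le_one`). -/

namespace ConeMeasure

/-! ### One-dimensional `p`-Gaussian weights, with bounds uniform in `p` -/

/-- The unnormalised density `e^{-|t|^p}` of the one-dimensional `p`-Gaussian law. -/
noncomputable def gaussWeight (p t : ℝ) : ℝ := Real.exp (-|t| ^ p)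

theorem gaussWeight_pos (p t : ℝ) : 0 < gaussWeight p t := Real.exp_pos _

theorem measurable_gaussWeight (p : ℝ) : Measurable (gaussWeight p) := by
  unfold gaussWeight
  fun_prop

theorem gaussWeight_neg (p t : ℝ) : gaussWeight p (-t) = gaussWeight p t := by
  simp [gaussWeight]

theorem abs_le_one_add_abs_rpow {p : ℝ} (hp : 1 ≤ p) (t : ℝ) : |t| ≤ 1 + |t| ^ p := by
  rcases le_total |t| 1 with h | h
  · linarith [Real.rpow_nonneg (abs_nonneg t) p]
  · linarith [Real.self_le_rpow_of_one_le h hp]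

theorem integral_exp_neg_half_abs : ∫ t : ℝ, Real.exp (-(1 / 2) * |t|) = 4 := by
  rw [integral_comp_abs (f := fun x => Real.exp (-(1 / 2) * x)),
    integral_exp_mul_Ioi (by norm_num)]
  norm_num

theorem integrable_exp_neg_half_abs :
    Integrable (fun t : ℝ => Real.exp (-(1 / 2) * |t|)) := by
  -- A non-integrable function has Bochner integral `0`, so the value `4` already forces
  -- integrability.
  by_contra h
  have h4 := integral_exp_neg_half_abs
  rw [integral_undef h] at h4
  norm_num at h4

/-- Since `|t|^p ≥ |t| - 1`, the weight is at most `e · e^{-|t|}`. Spending half of this decay on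
`e^{|t|/2}` leaves a majorant independent of `p`. -/
theorem exp_mul_gaussWeight_le {p : ℝ} (hp : 1 ≤ p) (t : ℝ) :
    Real.exp (|t| / 2) * gaussWeight p t ≤ Real.exp 1 * Real.exp (-(1 / 2) * |t|) := by
  rw [gaussWeight, ← Real.exp_add, ← Real.exp_add, Real.exp_le_exp]
  linarith [abs_le_one_add_abs_rpow hp t]

theorem integrable_exp_mul_gaussWeight {p : ℝ} (hp : 1 ≤ p) :
    Integrable (fun t : ℝ => Real.exp (|t| / 2) * gaussWeight p t) := by
  refine (integrable_exp_neg_half_abs.const_mul (Real.exp 1)).mono'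
    ((by fun_prop : Measurable fun t : ℝ => Real.exp (|t| / 2)).mul
      (measurable_gaussWeight p)).aestronglyMeasurable (Filter.Eventually.of_forall fun t => ?_)
  rw [Real.norm_of_nonneg (mul_nonneg (Real.exp_pos _).le (gaussWeight_pos p t).le)]
  exact exp_mul_gaussWeight_le hp t

theorem integral_exp_mul_gaussWeight_le {p : ℝ} (hp : 1 ≤ p) :
    ∫ t : ℝ, Real.exp (|t| / 2) * gaussWeight p t ≤ Real.exp 1 * 4 := by
  rw [← integral_exp_neg_half_abs, ← integral_const_mul]
  exact integral_mono (integrable_exp_mul_gaussWeight hp)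
    (integrable_exp_neg_half_abs.const_mul _) fun t => exp_mul_gaussWeight_le hp t

theorem gaussWeight_le_exp_mul (p t : ℝ) :
    gaussWeight p t ≤ Real.exp (|t| / 2) * gaussWeight p t :=
  le_mul_of_one_le_left (gaussWeight_pos p t).le (Real.one_le_exp (by positivity))

theorem integrable_gaussWeight {p : ℝ} (hp : 1 ≤ p) : Integrable (gaussWeight p) := by
  refine (integrable_exp_mul_gaussWeight hp).mono'
    (measurable_gaussWeight p).aestronglyMeasurable (Filter.Eventually.of_forall fun t => ?_)
  rw [Real.norm_of_nonneg (gaussWeight_pos p t).le]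
  exact gaussWeight_le_exp_mul p t

theorem integral_gaussWeight_le {p : ℝ} (hp : 1 ≤ p) :
    ∫ t, gaussWeight p t ≤ Real.exp 1 * 4 :=
  (integral_mono (integrable_gaussWeight hp) (integrable_exp_mul_gaussWeight hp)
    (gaussWeight_le_exp_mul p)).trans (integral_exp_mul_gaussWeight_le hp)

theorem le_integral_gaussWeight {p : ℝ} (hp : 1 ≤ p) :
    2 * Real.exp (-1) ≤ ∫ t, gaussWeight p t := by
  calc 2 * Real.exp (-1) = ∫ _ in Icc (-1 : ℝ) 1, Real.exp (-1) := by
        simp; norm_num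
    _ ≤ ∫ t in Icc (-1 : ℝ) 1, gaussWeight p t := by
        refine setIntegral_mono_on (by simp) (integrable_gaussWeight hp).integrableOn
          measurableSet_Icc fun t ht => ?_
        rw [gaussWeight, Real.exp_le_exp, neg_le_neg_iff]
        exact Real.rpow_le_one (abs_nonneg t) (abs_le.2 ht) (by linarith)
    _ ≤ ∫ t, gaussWeight p t :=
        setIntegral_le_integral (integrable_gaussWeight hp)
          (Filter.Eventually.of_forall fun t => (gaussWeight_pos p t).le)

theorem integral_gaussWeight_pos {p : ℝ} (hp : 1 ≤ p) : 0 < ∫ t, gaussWeight p t :=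
  lt_of_lt_of_le (by positivity) (le_integral_gaussWeight hp)

theorem integrable_rpow_mul_gaussWeight {p : ℝ} (hp : 1 ≤ p) (hp2 : p ≤ 2) :
    Integrable (fun t : ℝ => |t| ^ p * gaussWeight p t) := by
  refine ((integrable_exp_mul_gaussWeight hp).const_mul 9).mono'
    ((by fun_prop : Measurable fun t : ℝ => |t| ^ p).mul
      (measurable_gaussWeight p)).aestronglyMeasurable (Filter.Eventually.of_forall fun t => ?_)
  rw [Real.norm_of_nonneg (mul_nonneg (by positivity) (gaussWeight_pos p t).le), ← mul_assoc]
  refine mul_le_mul_of_nonneg_right ?_ (gaussWeight_pos p t).le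
  have h1 : 1 ≤ Real.exp (|t| / 2) := Real.one_le_exp (by positivity)
  rcases le_total |t| 1 with h | h
  · linarith [Real.rpow_le_one (abs_nonneg t) h (by linarith : 0 ≤ p)]
  · have h2 : |t| ^ p ≤ |t| ^ (2 : ℝ) := Real.rpow_le_rpow_of_exponent_le h hp2
    rw [Real.rpow_two] at h2
    have h3 := Real.pow_div_factorial_le_exp (|t| / 2) (by positivity) 2
    norm_num [Nat.factorial] at h3
    have h4 : |t| ^ 2 = t ^ 2 := sq_abs t
    linarith

/-- The exponent `-7` splits as `-4`, from `1 ≤ |t|^p ≤ 4` on `[1, 2]`, and `-3`, from the total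
mass being at most `4e ≤ e³`. -/
theorem le_integral_rpow_mul_gaussWeight {p : ℝ} (hp : 1 ≤ p) (hp2 : p ≤ 2) :
    Real.exp (-7) * ∫ t, gaussWeight p t ≤ ∫ t : ℝ, |t| ^ p * gaussWeight p t := by
  have hlow : Real.exp (-4) ≤ ∫ t : ℝ, |t| ^ p * gaussWeight p t := by
    calc Real.exp (-4) = ∫ _ in Icc (1 : ℝ) 2, Real.exp (-4) := by
          simp; norm_num
      _ ≤ ∫ t in Icc (1 : ℝ) 2, |t| ^ p * gaussWeight p t := by
          refine setIntegral_mono_on (by simp)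
            (integrable_rpow_mul_gaussWeight hp hp2).integrableOn measurableSet_Icc fun t ht => ?_
          have ht1 : 1 ≤ |t| := ht.1.trans (le_abs_self t)
          have ht2 : |t| ≤ 2 := by rw [abs_of_nonneg (by linarith [ht.1])]; exact ht.2
          have hle : |t| ^ p ≤ 4 :=
            calc |t| ^ p ≤ |t| ^ (2 : ℝ) := Real.rpow_le_rpow_of_exponent_le ht1 hp2
              _ = |t| ^ 2 := Real.rpow_two _
              _ ≤ 4 := by nlinarith
          refine le_trans ?_ (le_mul_of_one_le_left (gaussWeight_pos p t).le
            (Real.one_le_rpow ht1 (by linarith)))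
          rw [gaussWeight, Real.exp_le_exp]
          linarith
      _ ≤ ∫ t : ℝ, |t| ^ p * gaussWeight p t :=
          setIntegral_le_integral (integrable_rpow_mul_gaussWeight hp hp2)
            (Filter.Eventually.of_forall fun t =>
              mul_nonneg (by positivity) (gaussWeight_pos p t).le)
  refine le_trans ?_ hlow
  have he : (2 : ℝ) ≤ Real.exp 1 := by linarith [Real.exp_one_gt_d9]
  calc Real.exp (-7) * ∫ t, gaussWeight p t
      ≤ Real.exp (-7) * (Real.exp 1 * (Real.exp 1 * Real.exp 1)) := by
        gcongr
        exact (integral_gaussWeight_le hp).trans (by nlinarith [Real.exp_pos 1])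
    _ = Real.exp (-4) := by
        rw [← Real.exp_add, ← Real.exp_add, ← Real.exp_add]; norm_num

/-- Follows from `cosh y = 1 + 2 sinh²(|y|/2)` and `sinh z ≤ z e^z`. The factor `y²` is what yields
a quadratic exponent in the exponential moment. -/
theorem cosh_le_one_add_sq_mul_exp (y : ℝ) :
    Real.cosh y ≤ 1 + y ^ 2 / 2 * Real.exp |y| := by
  have key : ∀ z : ℝ, 0 ≤ z → Real.sinh z ≤ z * Real.exp z := fun z _ => by
    rw [Real.sinh_eq]
    have h1 := Real.add_one_le_exp (-(2 * z))
    have h2 : Real.exp (-z) = Real.exp z * Real.exp (-(2 * z)) := by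
      rw [← Real.exp_add]; ring_nf
    rw [h2]
    nlinarith [Real.exp_pos z]
  have hz : 0 ≤ |y| / 2 := by positivity
  have h1 : Real.cosh y = 1 + 2 * Real.sinh (|y| / 2) ^ 2 := by
    rw [← Real.cosh_abs y]
    conv_lhs => rw [show |y| = 2 * (|y| / 2) by ring]
    rw [Real.cosh_two_mul, Real.cosh_sq]; ring
  have h2 : Real.sinh (|y| / 2) ^ 2 ≤ (|y| / 2 * Real.exp (|y| / 2)) ^ 2 :=
    pow_le_pow_left₀ (Real.sinh_nonneg_iff.2 hz) (key _ hz) 2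
  have h3 : Real.exp (|y| / 2) ^ 2 = Real.exp |y| := by
    rw [← Real.exp_nat_mul]; push_cast; ring_nf
  rw [mul_pow, h3, div_pow, sq_abs] at h2
  linarith

theorem integrable_exp_linear_mul_gaussWeight {p : ℝ} (hp : 1 ≤ p) {s : ℝ}
    (hs : |s| ≤ 1 / 4) : Integrable (fun t : ℝ => Real.exp (s * t) * gaussWeight p t) := by
  refine (integrable_exp_mul_gaussWeight hp).mono'
    ((by fun_prop : Measurable fun t : ℝ => Real.exp (s * t)).mul
      (measurable_gaussWeight p)).aestronglyMeasurable (Filter.Eventually.of_forall fun t => ?_)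
  rw [Real.norm_of_nonneg (mul_nonneg (Real.exp_pos _).le (gaussWeight_pos p t).le)]
  refine mul_le_mul_of_nonneg_right (Real.exp_le_exp.2 ?_) (gaussWeight_pos p t).le
  have h := le_abs_self (s * t)
  rw [abs_mul] at h
  nlinarith [abs_nonneg t]

/-- The `p`-Gaussian law is subexponential, uniformly in `p`. -/
theorem integral_exp_linear_mul_gaussWeight_le {p : ℝ} (hp : 1 ≤ p) {s : ℝ}
    (hs : |s| ≤ 1 / 4) :
    ∫ t : ℝ, Real.exp (s * t) * gaussWeight p t
      ≤ Real.exp (300 * s ^ 2) * ∫ t, gaussWeight p t := by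
  have hI := integrable_exp_linear_mul_gaussWeight hp hs
  have hI' : Integrable (fun t : ℝ => Real.exp (-s * t) * gaussWeight p t) :=
    integrable_exp_linear_mul_gaussWeight hp (by rwa [abs_neg])
  have hsymm : ∫ t : ℝ, Real.exp (-s * t) * gaussWeight p t
      = ∫ t : ℝ, Real.exp (s * t) * gaussWeight p t := by
    rw [← integral_neg_eq_self]
    simp [gaussWeight_neg]
  -- Evenness of the weight replaces `exp` by `cosh`, which removes the term linear in `s`.
  have hcosh : ∫ t : ℝ, Real.exp (s * t) * gaussWeight p t
      = ∫ t : ℝ, Real.cosh (s * t) * gaussWeight p t := by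
    have h2 := integral_add hI hI'
    rw [hsymm] at h2
    have h3 : ∫ t : ℝ, Real.cosh (s * t) * gaussWeight p t
        = (1 / 2) * ∫ t : ℝ, (Real.exp (s * t) * gaussWeight p t
          + Real.exp (-s * t) * gaussWeight p t) := by
      rw [← integral_const_mul]
      refine integral_congr_ae (Filter.Eventually.of_forall fun t => ?_)
      simp only [Real.cosh_eq, neg_mul]
      ring
    rw [h3, h2]
    ring
  -- The `16` is `4²`: the quadratic term of `e^{|t|/4}` absorbs `t²/2`, and the other `e^{|t|/4}`
  -- comes from `|s| ≤ 1/4`.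
  have hpt : ∀ t : ℝ, Real.cosh (s * t) ≤ 1 + 16 * s ^ 2 * Real.exp (|t| / 2) := fun t => by
    refine (cosh_le_one_add_sq_mul_exp (s * t)).trans ?_
    have h1 : Real.exp |s * t| ≤ Real.exp (|t| / 4) := by
      rw [Real.exp_le_exp, abs_mul]
      nlinarith [abs_nonneg t]
    have h2 := Real.pow_div_factorial_le_exp (|t| / 4) (by positivity) 2
    have h3 : t ^ 2 / 2 ≤ 16 * Real.exp (|t| / 4) := by
      norm_num [Nat.factorial, div_pow, sq_abs] at h2
      linarith
    have h4 : Real.exp (|t| / 2) = Real.exp (|t| / 4) * Real.exp (|t| / 4) := by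
      rw [← Real.exp_add]; ring_nf
    rw [h4]
    calc 1 + (s * t) ^ 2 / 2 * Real.exp |s * t|
        = 1 + s ^ 2 * (t ^ 2 / 2 * Real.exp |s * t|) := by ring
      _ ≤ 1 + s ^ 2 * (16 * Real.exp (|t| / 4) * Real.exp (|t| / 4)) := by gcongr
      _ = _ := by ring
  have hint2 : Integrable (fun t : ℝ => gaussWeight p t
      + 16 * s ^ 2 * (Real.exp (|t| / 2) * gaussWeight p t)) :=
    (integrable_gaussWeight hp).add ((integrable_exp_mul_gaussWeight hp).const_mul _)
  have hle : ∫ t : ℝ, Real.cosh (s * t) * gaussWeight p t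
      ≤ (∫ t, gaussWeight p t) + 16 * s ^ 2 * (Real.exp 1 * 4) := by
    calc ∫ t : ℝ, Real.cosh (s * t) * gaussWeight p t
        ≤ ∫ t : ℝ, (gaussWeight p t + 16 * s ^ 2 * (Real.exp (|t| / 2) * gaussWeight p t)) := by
          refine integral_mono_of_nonneg (Filter.Eventually.of_forall fun t =>
            mul_nonneg (Real.cosh_pos _).le (gaussWeight_pos p t).le) hint2
            (Filter.Eventually.of_forall fun t => ?_)
          have := mul_le_mul_of_nonneg_right (hpt t) (gaussWeight_pos p t).le
          simp only
          linarith
      _ = (∫ t, gaussWeight p t)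
          + 16 * s ^ 2 * ∫ t, Real.exp (|t| / 2) * gaussWeight p t := by
          rw [integral_add (integrable_gaussWeight hp)
            ((integrable_exp_mul_gaussWeight hp).const_mul _), integral_const_mul]
      _ ≤ _ := by
          gcongr
          exact integral_exp_mul_gaussWeight_le hp
  rw [hcosh]
  refine hle.trans ?_
  have hZ := le_integral_gaussWeight hp
  set Z := ∫ t, gaussWeight p t
  have hZ0 : 0 < Z := integral_gaussWeight_pos hp
  -- From `Z ≥ 2/e` and `e² ≤ 9`; then `16 · 18 = 288 ≤ 300`.
  have he2 : Real.exp 1 * 4 ≤ 18 * Z := by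
    have h1 : Real.exp 1 * Real.exp (-1) = 1 := by rw [← Real.exp_add]; simp
    have h2 : Real.exp 1 * Real.exp 1 ≤ 9 := by
      nlinarith [Real.exp_one_lt_d9, Real.exp_pos 1]
    nlinarith [Real.exp_pos (-1), Real.exp_pos 1]
  calc Z + 16 * s ^ 2 * (Real.exp 1 * 4) ≤ Z + 16 * s ^ 2 * (18 * Z) := by gcongr
    _ ≤ (300 * s ^ 2 + 1) * Z := by nlinarith [mul_nonneg (sq_nonneg s) hZ0.le]
    _ ≤ Real.exp (300 * s ^ 2) * Z := by
      gcongr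
      exact Real.add_one_le_exp _


/-! ### The `ℓ_p` norm, its ball and the radial projection -/

theorem pNorm_nonneg {n : ℕ} (p : ℝ) (x : Fin n → ℝ) : 0 ≤ pNorm p x :=
  Real.rpow_nonneg (Finset.sum_nonneg fun _ _ => Real.rpow_nonneg (abs_nonneg _) _) _

theorem pNorm_rpow {n : ℕ} {p : ℝ} (hp : 1 ≤ p) (x : Fin n → ℝ) :
    pNorm p x ^ p = ∑ i, |x i| ^ p := by
  rw [pNorm, ← Real.rpow_mul (Finset.sum_nonneg fun _ _ => Real.rpow_nonneg (abs_nonneg _) _),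
    one_div_mul_cancel (by linarith), Real.rpow_one]

theorem abs_le_pNorm {n : ℕ} {p : ℝ} (hp : 1 ≤ p) (x : Fin n → ℝ) (i : Fin n) :
    |x i| ≤ pNorm p x := by
  refine (Real.rpow_le_rpow_iff (abs_nonneg _) (pNorm_nonneg p x) (by linarith : 0 < p)).1 ?_
  rw [pNorm_rpow hp]
  exact Finset.single_le_sum (f := fun i => |x i| ^ p)
    (fun _ _ => Real.rpow_nonneg (abs_nonneg _) _) (Finset.mem_univ i)

theorem pNorm_zero {n : ℕ} {p : ℝ} (hp : 1 ≤ p) : pNorm p (0 : Fin n → ℝ) = 0 := by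
  simpa using pNorm_smul hp le_rfl (0 : Fin n → ℝ)

theorem pNorm_pos {n : ℕ} {p : ℝ} (hp : 1 ≤ p) {x : Fin n → ℝ} (hx : x ≠ 0) :
    0 < pNorm p x := by
  obtain ⟨i, hi⟩ := Function.ne_iff.1 hx
  exact (abs_pos.2 hi).trans_le (abs_le_pNorm hp x i)

theorem continuous_pNorm {n : ℕ} {p : ℝ} (hp : 1 ≤ p) :
    Continuous (fun x : Fin n → ℝ => pNorm p x) := by
  have h1 : (0 : ℝ) ≤ p := by linarith
  have h2 : (0 : ℝ) ≤ 1 / p := by positivity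
  unfold pNorm
  exact (continuous_finsetSum _ fun i _ =>
    (continuous_apply i).abs.rpow_const fun _ => Or.inr h1).rpow_const fun _ => Or.inr h2

theorem volume_pBall_ne_top {n : ℕ} {p : ℝ} (hp : 1 ≤ p) : volume (pBall n p) ≠ ∞ := by
  refine ne_top_of_le_ne_top (measure_closedBall_lt_top (x := (0 : Fin n → ℝ)) (r := 1)).ne
    (measure_mono fun x hx => ?_)
  rw [mem_closedBall_zero_iff, pi_norm_le_iff_of_nonneg zero_le_one]
  exact fun i => (abs_le_pNorm hp x i).trans hx

theorem volume_pBall_ne_zero {n : ℕ} {p : ℝ} (hp : 1 ≤ p) : volume (pBall n p) ≠ 0 := by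
  have ho : IsOpen {x : Fin n → ℝ | pNorm p x < 1} :=
    isOpen_lt (continuous_pNorm hp) continuous_const
  refine ((ho.measure_pos volume ⟨0, ?_⟩).trans_le (measure_mono fun x hx => ?_)).ne'
  · simp [pNorm_zero hp]
  · exact (show pNorm p x < 1 from hx).le

/-- The radial projection `x ↦ x / ‖x‖_p` onto the sphere. -/
noncomputable def radialProj {n : ℕ} (p : ℝ) (x : Fin n → ℝ) : Fin n → ℝ := (pNorm p x)⁻¹ • x

theorem measurable_radialProj {n : ℕ} (p : ℝ) :
    Measurable (radialProj p : (Fin n → ℝ) → Fin n → ℝ) :=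
  (measurable_pNorm p).inv.smul measurable_id

theorem radialProj_mem {n : ℕ} {p : ℝ} (hp : 1 ≤ p) {x : Fin n → ℝ} (hx : x ≠ 0) :
    radialProj p x ∈ pSphere n p := by
  have h := pNorm_pos hp hx
  change pNorm p (radialProj p x) = 1
  rw [radialProj, pNorm_smul hp (inv_nonneg.2 h.le), inv_mul_cancel₀ h.ne']

theorem radialProj_smul {n : ℕ} {p : ℝ} (hp : 1 ≤ p) {r : ℝ} (hr : 0 < r) (x : Fin n → ℝ) :
    radialProj p (r • x) = radialProj p x := by
  rw [radialProj, pNorm_smul hp hr.le, mul_inv, smul_smul, radialProj]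
  congr 1
  field_simp

theorem smul_radialProj {n : ℕ} {p : ℝ} (hp : 1 ≤ p) (x : Fin n → ℝ) :
    pNorm p x • radialProj p x = x := by
  rcases eq_or_ne x 0 with rfl | hx
  · simp [radialProj]
  · rw [radialProj, smul_smul, mul_inv_cancel₀ (pNorm_pos hp hx).ne', one_smul]

/-! ### Polar integration with respect to the cone measure -/

/-- The cone over the part of the sphere in `A` and the truncated sector differ at most at the
origin, a null set because `n ≥ 1`. -/
theorem map_coneMeasure_apply {n : ℕ} (hn : 1 ≤ n) {p : ℝ} (hp : 1 ≤ p)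
    {A : Set (Fin n → ℝ)} (hA : MeasurableSet A) :
    (coneMeasure n p hp).map Subtype.val A
      = volume (radialProj p ⁻¹' A ∩ pBall n p) / volume (pBall n p) := by
  have : Nonempty (Fin n) := ⟨⟨0, hn⟩⟩
  rw [Measure.map_apply measurable_subtype_coe hA, coneMeasure,
    Measure.ofMeasurable_apply _ (measurable_subtype_coe hA), Subtype.image_preimage_coe]
  congr 1
  have hsub : pSphere n p ∩ A ⊆ pSphere n p := inter_subset_left
  rw [← measure_sdiff_null (s := cone _) (measure_singleton (0 : Fin n → ℝ)),
    cone_diff_zero hp hsub,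
    ← measure_sdiff_null (s := _ ∩ _) (measure_singleton (0 : Fin n → ℝ))]
  congr 1
  ext y
  constructor
  · rintro ⟨h0, h1, h2⟩
    refine ⟨⟨h2.2, h1⟩, ?_⟩
    rintro rfl
    exact h0.ne' (pNorm_zero hp)
  · rintro ⟨⟨h1, h2⟩, h3⟩
    exact ⟨pNorm_pos hp h3, h2, radialProj_mem hp h3, h1⟩

/-- Sectors are invariant under positive dilations, so for `r > 0` both truncations scale by the
same power of `r`; for `r ≤ 0` both are null. -/
theorem volume_radialProj_inter {n : ℕ} (hn : 1 ≤ n) {p : ℝ} (hp : 1 ≤ p)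
    {A : Set (Fin n → ℝ)} (r : ℝ) :
    volume (radialProj p ⁻¹' A ∩ {x : Fin n → ℝ | pNorm p x ≤ r}) * volume (pBall n p)
      = volume (radialProj p ⁻¹' A ∩ pBall n p) * volume {x : Fin n → ℝ | pNorm p x ≤ r} := by
  have : Nonempty (Fin n) := ⟨⟨0, hn⟩⟩
  rcases le_or_gt r 0 with hr | hr
  · have h0 : volume {x : Fin n → ℝ | pNorm p x ≤ r} = 0 := by
      refine measure_mono_null (fun x hx => ?_) (measure_singleton (0 : Fin n → ℝ))
      by_contra h
      exact absurd (pNorm_pos hp h) (not_lt.2 (le_trans hx hr))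
    rw [h0, measure_mono_null inter_subset_right h0, zero_mul, mul_zero]
  · have hs : ∀ B : Set (Fin n → ℝ), volume (radialProj p ⁻¹' B ∩ {x | pNorm p x ≤ r})
        = ENNReal.ofReal |((r⁻¹) ^ Module.finrank ℝ (Fin n → ℝ))⁻¹|
          * volume (radialProj p ⁻¹' B ∩ pBall n p) := fun B => by
      rw [← Measure.addHaar_preimage_smul volume (inv_ne_zero hr.ne')]
      congr 1
      ext x
      have h1 : pNorm p (r⁻¹ • x) ≤ 1 ↔ pNorm p x ≤ r := by
        rw [pNorm_smul hp (inv_nonneg.2 hr.le), inv_mul_le_iff₀ hr, mul_one]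
      simp only [mem_inter_iff, mem_preimage, radialProj_smul hp (inv_pos.2 hr), pBall,
        mem_ofPred_eq, h1]
    have hu := hs univ
    simp only [preimage_univ, univ_inter] at hu
    rw [hs A, hu]
    ring

/-- The radial part of Lebesgue measure over a sector is proportional to that of the whole
space, with factor the cone measure of the sector. -/
theorem setLIntegral_radial {n : ℕ} (hn : 1 ≤ n) {p : ℝ} (hp : 1 ≤ p) {A : Set (Fin n → ℝ)}
    (hA : MeasurableSet A) {w : ℝ → ℝ≥0∞} (hw : Measurable w) :
    ∫⁻ x in radialProj p ⁻¹' A, w (pNorm p x)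
      = (coneMeasure n p hp).map Subtype.val A * ∫⁻ x : Fin n → ℝ, w (pNorm p x) := by
  have hN := measurable_pNorm (n := n) p
  have hb0 := volume_pBall_ne_zero (n := n) hp
  have hbt := volume_pBall_ne_top (n := n) hp
  -- Two measures on the line, finite on each `Iic k`, agree once they agree on all half-lines `Iic
  -- r`, where the claim is the scaling identity.
  have key : Measure.map (pNorm p) (volume.restrict (radialProj p ⁻¹' A))
      = (coneMeasure n p hp).map Subtype.val A •
        Measure.map (pNorm p) (volume : Measure (Fin n → ℝ)) := by
    refine Measure.ext_of_generateFrom_of_iUnion (range Iic) (fun k : ℕ => Iic (k : ℝ))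
      (by rw [← borel_eq_generateFrom_Iic]; exact BorelSpace.measurable_eq)
      isPiSystem_Iic ?_ (fun k => ⟨_, rfl⟩) (fun k => ?_) ?_
    · refine eq_univ_of_forall fun x => mem_iUnion.2 ?_
      exact exists_nat_ge x
    · rw [Measure.map_apply hN measurableSet_Iic]
      refine ne_top_of_le_ne_top ?_ (Measure.restrict_apply_le _ _)
      refine ne_top_of_le_ne_top
        (measure_closedBall_lt_top (x := (0 : Fin n → ℝ)) (r := k)).ne
        (measure_mono fun x hx => ?_)
      rw [mem_closedBall_zero_iff, pi_norm_le_iff_of_nonneg (Nat.cast_nonneg k)]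
      exact fun i => (abs_le_pNorm hp x i).trans hx
    · rintro _ ⟨r, rfl⟩
      rw [Measure.smul_apply, Measure.map_apply hN measurableSet_Iic,
        Measure.map_apply hN measurableSet_Iic, Measure.restrict_apply (hN measurableSet_Iic),
        map_coneMeasure_apply hn hp hA, smul_eq_mul, inter_comm]
      have h := volume_radialProj_inter hn hp (A := A) r
      have e : (pNorm p ⁻¹' Iic r : Set (Fin n → ℝ)) = {x | pNorm p x ≤ r} := rfl
      rw [e, ENNReal.div_eq_inv_mul, mul_assoc, ← h, mul_comm (volume _) (volume (pBall n p)),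
        ← mul_assoc, ENNReal.inv_mul_cancel hb0 hbt, one_mul]
  rw [← lintegral_map hw hN, key, lintegral_smul_measure, lintegral_map hw hN, smul_eq_mul]

/-- Polar integration: under a radial density, the direction has the cone measure as law. -/
theorem lintegral_radialProj_mul {n : ℕ} (hn : 1 ≤ n) {p : ℝ} (hp : 1 ≤ p)
    {H : (Fin n → ℝ) → ℝ≥0∞} (hH : Measurable H) {w : ℝ → ℝ≥0∞} (hw : Measurable w) :
    ∫⁻ x : Fin n → ℝ, w (pNorm p x) * H (radialProj p x)
      = (∫⁻ y, H y ∂coneMeasure n p hp) * ∫⁻ x : Fin n → ℝ, w (pNorm p x) := by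
  have hN := measurable_pNorm (n := n) p
  have hT := measurable_radialProj (n := n) p
  have hwN : Measurable fun x : Fin n → ℝ => w (pNorm p x) := hw.comp hN
  have key : Measure.map (radialProj p) ((volume : Measure (Fin n → ℝ)).withDensity
        fun x => w (pNorm p x))
      = (∫⁻ x : Fin n → ℝ, w (pNorm p x)) • (coneMeasure n p hp).map Subtype.val := by
    ext A hA
    rw [Measure.map_apply hT hA, withDensity_apply _ (hT hA), setLIntegral_radial hn hp hA hw,
      Measure.smul_apply, smul_eq_mul, mul_comm]
  rw [← lintegral_map hH measurable_subtype_coe, mul_comm (lintegral _ _), ← smul_eq_mul,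
    ← lintegral_smul_measure, ← key, lintegral_map hH hT,
    lintegral_withDensity_eq_lintegral_mul (g := fun x => H (radialProj p x)) _ hwN (hH.comp hT)]
  rfl


/-! ### The `p`-Gaussian vector: exponential moments and moments of its norm -/

theorem lintegral_ofReal_prod {n : ℕ} {f : Fin n → ℝ → ℝ} (h0 : ∀ i t, 0 ≤ f i t)
    (hf : ∀ i, Integrable (f i)) :
    ∫⁻ x : Fin n → ℝ, ENNReal.ofReal (∏ i, f i (x i)) = ENNReal.ofReal (∏ i, ∫ t, f i t) := by
  rw [← integral_fintype_prod_volume_eq_prod, ofReal_integral_eq_lintegral_ofReal]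
  · exact Integrable.fintype_prod hf
  · exact Filter.Eventually.of_forall fun x => Finset.prod_nonneg fun i _ => h0 i (x i)

theorem prod_gaussWeight {n : ℕ} {p : ℝ} (hp : 1 ≤ p) (x : Fin n → ℝ) :
    ∏ i, gaussWeight p (x i) = Real.exp (-pNorm p x ^ p) := by
  simp only [gaussWeight]
  rw [← Real.exp_sum, Finset.sum_neg_distrib, pNorm_rpow hp]

theorem lintegral_exp_neg_pNorm {n : ℕ} {p : ℝ} (hp : 1 ≤ p) :
    ∫⁻ x : Fin n → ℝ, ENNReal.ofReal (Real.exp (-pNorm p x ^ p))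
      = ENNReal.ofReal ((∫ t, gaussWeight p t) ^ n) := by
  simp_rw [← prod_gaussWeight hp]
  rw [lintegral_ofReal_prod (fun _ t => (gaussWeight_pos p t).le)
    (fun _ => integrable_gaussWeight hp)]
  simp

theorem lintegral_exp_inner_le {n : ℕ} {p : ℝ} (hp : 1 ≤ p) {θ : Fin n → ℝ}
    (hθ : ∀ i, |θ i| ≤ 1) {s : ℝ} (hs : |s| ≤ 1 / 4) :
    ∫⁻ x : Fin n → ℝ,
        ENNReal.ofReal (Real.exp (s * ∑ i, x i * θ i) * Real.exp (-pNorm p x ^ p))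
      ≤ ENNReal.ofReal (Real.exp (300 * s ^ 2 * n) * (∫ t, gaussWeight p t) ^ n) := by
  have hsθ : ∀ i, |s * θ i| ≤ |s| := fun i => by
    rw [abs_mul]
    exact mul_le_of_le_one_right (abs_nonneg s) (hθ i)
  have hpt : ∀ x : Fin n → ℝ, Real.exp (s * ∑ i, x i * θ i) * Real.exp (-pNorm p x ^ p)
      = ∏ i, Real.exp (s * θ i * x i) * gaussWeight p (x i) := fun x => by
    rw [Finset.prod_mul_distrib, prod_gaussWeight hp, ← Real.exp_sum, Finset.mul_sum]
    congr 3
    exact funext fun i => by ring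
  simp_rw [hpt]
  rw [lintegral_ofReal_prod (f := fun i t => Real.exp (s * θ i * t) * gaussWeight p t)
    (fun i t => mul_nonneg (Real.exp_pos _).le (gaussWeight_pos p t).le)
    (fun i => integrable_exp_linear_mul_gaussWeight hp ((hsθ i).trans hs))]
  refine ENNReal.ofReal_le_ofReal ?_
  calc ∏ i, ∫ t, Real.exp (s * θ i * t) * gaussWeight p t
      ≤ ∏ _i : Fin n, Real.exp (300 * s ^ 2) * ∫ t, gaussWeight p t := by
        refine Finset.prod_le_prod (fun i _ => integral_nonneg fun t =>
          mul_nonneg (Real.exp_pos _).le (gaussWeight_pos p t).le) fun i _ => ?_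
        refine (integral_exp_linear_mul_gaussWeight_le hp ((hsθ i).trans hs)).trans ?_
        have h : (s * θ i) ^ 2 ≤ s ^ 2 := sq_le_sq.2 (hsθ i)
        have hZ := (integral_gaussWeight_pos hp).le
        gcongr
    _ = Real.exp (300 * s ^ 2 * n) * (∫ t, gaussWeight p t) ^ n := by
        rw [Finset.prod_const, Finset.card_univ, Fintype.card_fin, mul_pow, ← Real.exp_nat_mul]
        congr 2
        ring

/-- Expanding `‖x‖_p^p = ∑ |x i|^p` gives `n` product integrals, each with one factor changed to the
one-dimensional `p`-th moment. -/
theorem le_lintegral_pNorm_rpow {n : ℕ} {p : ℝ} (hp : 1 ≤ p) (hp2 : p ≤ 2) :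
    ENNReal.ofReal (n * Real.exp (-7) * (∫ t, gaussWeight p t) ^ n)
      ≤ ∫⁻ x : Fin n → ℝ, ENNReal.ofReal (pNorm p x ^ p * Real.exp (-pNorm p x ^ p)) := by
  set Z := ∫ t, gaussWeight p t with hZ
  have hZ0 : 0 < Z := integral_gaussWeight_pos hp
  let f : Fin n → Fin n → ℝ → ℝ := fun i j t => (if j = i then |t| ^ p else 1) * gaussWeight p t
  have hf0 : ∀ i j t, 0 ≤ f i j t := fun i j t => by
    refine mul_nonneg ?_ (gaussWeight_pos p t).le
    split_ifs
    · positivity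
    · exact zero_le_one
  have hfi : ∀ i j, Integrable (f i j) := fun i j => by
    by_cases h : j = i
    · simpa [f, h] using integrable_rpow_mul_gaussWeight hp hp2
    · simpa [f, h] using integrable_gaussWeight hp
  have hpt : ∀ x : Fin n → ℝ, ENNReal.ofReal (pNorm p x ^ p * Real.exp (-pNorm p x ^ p))
      = ∑ i, ENNReal.ofReal (∏ j, f i j (x j)) := fun x => by
    rw [← ENNReal.ofReal_sum_of_nonneg fun i _ => Finset.prod_nonneg fun j _ => hf0 i j (x j)]
    congr 1
    rw [← prod_gaussWeight hp, pNorm_rpow hp, Finset.sum_mul]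
    refine Finset.sum_congr rfl fun i _ => ?_
    simp only [f, Finset.prod_mul_distrib, Finset.prod_ite_eq', Finset.mem_univ, if_true]
  simp_rw [hpt]
  rw [lintegral_finsetSum]
  swap
  · intro i _
    refine ENNReal.measurable_ofReal.comp (Finset.measurable_prod _ fun j _ => ?_)
    have hm : Measurable (f i j) := by
      refine Measurable.mul ?_ (measurable_gaussWeight p)
      split_ifs <;> fun_prop
    exact hm.comp (measurable_pi_apply j)
  have hterm : ∀ i, ENNReal.ofReal (Real.exp (-7) * Z ^ n)
      ≤ ∫⁻ x : Fin n → ℝ, ENNReal.ofReal (∏ j, f i j (x j)) := fun i => by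
    rw [lintegral_ofReal_prod (hf0 i) (hfi i)]
    refine ENNReal.ofReal_le_ofReal ?_
    calc Real.exp (-7) * Z ^ n = ∏ j, (if j = i then Real.exp (-7) else 1) * Z := by
          rw [Finset.prod_mul_distrib]; simp
      _ ≤ ∏ j, ∫ t, f i j t := by
          refine Finset.prod_le_prod (fun j _ => ?_) fun j _ => ?_
          · split_ifs <;> positivity
          · by_cases h : j = i
            · simpa [f, h] using le_integral_rpow_mul_gaussWeight hp hp2
            · simp [f, h, hZ]
  calc ENNReal.ofReal (n * Real.exp (-7) * Z ^ n)
      = ∑ _i : Fin n, ENNReal.ofReal (Real.exp (-7) * Z ^ n) := by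
        rw [Finset.sum_const, Finset.card_univ, Fintype.card_fin, nsmul_eq_mul, mul_assoc,
          ENNReal.ofReal_mul (Nat.cast_nonneg n), ENNReal.ofReal_natCast]
    _ ≤ _ := Finset.sum_le_sum fun i _ => hterm i

/-- Jensen's inequality for the moments of the `ℓ_p` norm of a `p`-Gaussian vector. -/
theorem le_lintegral_pNorm_pow {n : ℕ} (hn : 1 ≤ n) {p : ℝ} (hp : 1 ≤ p) (hp2 : p ≤ 2) {m : ℕ}
    (hm : 2 ≤ m) :
    ENNReal.ofReal ((n * Real.exp (-7)) ^ (m / p) * (∫ t, gaussWeight p t) ^ n)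
      ≤ ∫⁻ x : Fin n → ℝ, ENNReal.ofReal (pNorm p x ^ m * Real.exp (-pNorm p x ^ p)) := by
  have hp0 : 0 < p := by linarith
  have hn0 : (0 : ℝ) < n := by exact_mod_cast hn
  set a : ℝ := m / p with ha_def
  have ha : 1 ≤ a := by
    rw [ha_def, one_le_div hp0]
    exact hp2.trans (by exact_mod_cast hm)
  set b : ℝ := n * Real.exp (-7) with hb_def
  have hb : 0 < b := by positivity
  have hI := lintegral_exp_neg_pNorm (n := n) hp
  have hL := le_lintegral_pNorm_rpow (n := n) hp hp2
  set Z := ∫ t, gaussWeight p t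
  have hZ0 : 0 < Z := integral_gaussWeight_pos hp
  have hba : 0 < b ^ a := Real.rpow_pos_of_pos hb a
  -- The tangent line of `S ↦ S^a` at `b`, from Bernoulli's inequality. Its negative part is moved
  -- to the right so that all terms stay nonnegative for `lintegral`; the finite surplus is
  -- cancelled at the end.
  have hpt : ∀ x : Fin n → ℝ,
      b ^ a * a / b * (pNorm p x ^ p * Real.exp (-pNorm p x ^ p))
        ≤ pNorm p x ^ m * Real.exp (-pNorm p x ^ p)
          + b ^ a * (a - 1) * Real.exp (-pNorm p x ^ p) := fun x => by
    have hS : 0 ≤ pNorm p x ^ p := Real.rpow_nonneg (pNorm_nonneg p x) p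
    have hSa : (pNorm p x ^ p) ^ a = pNorm p x ^ m := by
      rw [← Real.rpow_mul (pNorm_nonneg p x), ha_def, mul_div_cancel₀ _ hp0.ne',
        Real.rpow_natCast]
    set S := pNorm p x ^ p
    have hB := one_add_mul_self_le_rpow_one_add (s := S / b - 1)
      (by linarith [div_nonneg hS hb.le]) ha
    rw [add_sub_cancel, Real.div_rpow hS hb.le, hSa, le_div_iff₀ hba] at hB
    rw [← mul_assoc, ← add_mul]
    refine mul_le_mul_of_nonneg_right ?_ (Real.exp_pos _).le
    calc b ^ a * a / b * S = (1 + a * (S / b - 1)) * b ^ a + b ^ a * (a - 1) := by ring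
      _ ≤ _ := by linarith
  have hmeas : Measurable fun x : Fin n → ℝ => Real.exp (-pNorm p x ^ p) :=
    Real.measurable_exp.comp ((measurable_pNorm p).pow_const p).neg
  have hint : ENNReal.ofReal (b ^ a * a / b) * ENNReal.ofReal (b * Z ^ n)
      ≤ (∫⁻ x : Fin n → ℝ, ENNReal.ofReal (pNorm p x ^ m * Real.exp (-pNorm p x ^ p)))
        + ENNReal.ofReal (b ^ a * (a - 1)) * ENNReal.ofReal (Z ^ n) := by
    have h1 : 0 ≤ b ^ a * a / b := by positivity
    have h2 : 0 ≤ b ^ a * (a - 1) := mul_nonneg hba.le (by linarith)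
    calc _ ≤ ENNReal.ofReal (b ^ a * a / b) * ∫⁻ x : Fin n → ℝ,
            ENNReal.ofReal (pNorm p x ^ p * Real.exp (-pNorm p x ^ p)) := by gcongr
      _ = ∫⁻ x : Fin n → ℝ, ENNReal.ofReal
            (b ^ a * a / b * (pNorm p x ^ p * Real.exp (-pNorm p x ^ p))) := by
          rw [← lintegral_const_mul' _ _ ENNReal.ofReal_ne_top]
          simp_rw [ENNReal.ofReal_mul h1]
      _ ≤ ∫⁻ x : Fin n → ℝ, (ENNReal.ofReal (pNorm p x ^ m * Real.exp (-pNorm p x ^ p))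
            + ENNReal.ofReal (b ^ a * (a - 1)) * ENNReal.ofReal (Real.exp (-pNorm p x ^ p))) := by
          refine lintegral_mono fun x => ?_
          rw [← ENNReal.ofReal_mul h2, ← ENNReal.ofReal_add
            (mul_nonneg (pow_nonneg (pNorm_nonneg p x) m) (Real.exp_pos _).le)
            (mul_nonneg h2 (Real.exp_pos _).le)]
          exact ENNReal.ofReal_le_ofReal (hpt x)
      _ = _ := by
          rw [lintegral_add_right _ (hmeas.ennreal_ofReal.const_mul _),
            lintegral_const_mul' _ _ ENNReal.ofReal_ne_top, hI]
  rw [← ENNReal.ofReal_mul (by positivity),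
    ← ENNReal.ofReal_mul (mul_nonneg hba.le (by linarith))] at hint
  have hsplit : b ^ a * a / b * (b * Z ^ n) = b ^ a * Z ^ n + b ^ a * (a - 1) * Z ^ n := by
    field_simp
    ring
  rw [hsplit, ENNReal.ofReal_add (by positivity)
    (mul_nonneg (mul_nonneg hba.le (by linarith)) (by positivity))] at hint
  exact (ENNReal.add_le_add_iff_right ENNReal.ofReal_ne_top).1 hint

/-! ### Moments of linear forms, from the product law to the cone measure -/

/-- One term of the series for `e^{s|u|}`, with `e^{s|u|} ≤ e^{su} + e^{-su}`; it turns exponential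
moments into power moments. -/
theorem pow_le_factorial_mul_exp {s : ℝ} (hs : 0 < s) (u : ℝ) (k : ℕ) :
    u ^ (2 * k) ≤ (2 * k).factorial / s ^ (2 * k) * (Real.exp (s * u) + Real.exp (-s * u)) := by
  have h := Real.pow_div_factorial_le_exp (s * |u|) (by positivity) (2 * k)
  have h2 : Real.exp (s * |u|) ≤ Real.exp (s * u) + Real.exp (-s * u) := by
    rcases abs_cases u with ⟨h, _⟩ | ⟨h, _⟩ <;> rw [h]
    · linarith [Real.exp_pos (-s * u)]
    · rw [mul_neg, ← neg_mul]
      linarith [Real.exp_pos (s * u)]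
  have hf : (0 : ℝ) < (2 * k).factorial := by exact_mod_cast Nat.factorial_pos _
  have hs' : 0 < s ^ (2 * k) := by positivity
  rw [mul_pow, (even_two_mul k).pow_abs, div_le_iff₀ hf] at h
  rw [div_mul_eq_mul_div, le_div_iff₀ hs']
  nlinarith

theorem lintegral_inner_pow_le {n : ℕ} {p : ℝ} (hp : 1 ≤ p) {θ : Fin n → ℝ}
    (hθ : ∀ i, |θ i| ≤ 1) {s : ℝ} (hs0 : 0 < s) (hs : s ≤ 1 / 4) (k : ℕ) :
    ∫⁻ x : Fin n → ℝ,
        ENNReal.ofReal ((∑ i, x i * θ i) ^ (2 * k) * Real.exp (-pNorm p x ^ p))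
      ≤ ENNReal.ofReal ((2 * k).factorial / s ^ (2 * k) *
          (2 * (Real.exp (300 * s ^ 2 * n) * (∫ t, gaussWeight p t) ^ n))) := by
  have hE1 := lintegral_exp_inner_le hp hθ (s := s) (by rwa [abs_of_pos hs0])
  have hE2 := lintegral_exp_inner_le hp hθ (s := -s) (by rwa [abs_neg, abs_of_pos hs0])
  rw [neg_sq] at hE2
  have hZ := (integral_gaussWeight_pos hp).le
  set Z := ∫ t, gaussWeight p t
  have hc : (0 : ℝ) ≤ (2 * k).factorial / s ^ (2 * k) := by positivity
  have hW : Measurable fun x : Fin n → ℝ => Real.exp (-pNorm p x ^ p) :=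
    Real.measurable_exp.comp ((measurable_pNorm p).pow_const p).neg
  calc _ ≤ ∫⁻ x : Fin n → ℝ, ENNReal.ofReal ((2 * k).factorial / s ^ (2 * k)) *
        (ENNReal.ofReal (Real.exp (s * ∑ i, x i * θ i) * Real.exp (-pNorm p x ^ p))
          + ENNReal.ofReal (Real.exp (-s * ∑ i, x i * θ i) * Real.exp (-pNorm p x ^ p))) := by
        refine lintegral_mono fun x => ?_
        rw [← ENNReal.ofReal_add (by positivity) (by positivity), ← ENNReal.ofReal_mul hc,
          ← add_mul, ← mul_assoc]
        exact ENNReal.ofReal_le_ofReal (mul_le_mul_of_nonneg_right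
          (pow_le_factorial_mul_exp hs0 _ k) (Real.exp_pos _).le)
    _ ≤ _ := by
        rw [lintegral_const_mul' _ _ ENNReal.ofReal_ne_top, lintegral_add_right,
          two_mul (Real.exp (300 * s ^ 2 * n) * Z ^ n),
          ENNReal.ofReal_mul hc, ENNReal.ofReal_add (by positivity) (by positivity)]
        · gcongr
        · exact ((by fun_prop : Measurable fun x : Fin n → ℝ =>
            Real.exp (-s * ∑ i, x i * θ i)).mul hW).ennreal_ofReal

/-- The moments of a linear form under the cone measure and under the `p`-Gaussian law. -/
theorem lintegral_coneMeasure_mul_le {n : ℕ} (hn : 1 ≤ n) {p : ℝ} (hp : 1 ≤ p)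
    (hp2 : p ≤ 2) {θ : Fin n → ℝ} (hθ : ∀ i, |θ i| ≤ 1) {s : ℝ} (hs0 : 0 < s)
    (hs : s ≤ 1 / 4) {k : ℕ} (hk : 1 ≤ k) :
    ∫⁻ x, ENNReal.ofReal ((∑ i, (x : Fin n → ℝ) i * θ i) ^ (2 * k)) ∂coneMeasure n p hp
      ≤ ENNReal.ofReal ((2 * k).factorial / s ^ (2 * k) * (2 * Real.exp (300 * s ^ 2 * n))
          / (n * Real.exp (-7)) ^ ((2 * k : ℕ) / p)) := by
  have hn0 : (0 : ℝ) < n := by exact_mod_cast hn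
  have hw : Measurable fun r : ℝ => ENNReal.ofReal (r ^ (2 * k) * Real.exp (-r ^ p)) :=
    ((measurable_id.pow_const (2 * k)).mul
      (Real.measurable_exp.comp (measurable_id.pow_const p).neg)).ennreal_ofReal
  have hH : Measurable fun x : Fin n → ℝ => ENNReal.ofReal ((∑ i, x i * θ i) ^ (2 * k)) := by
    fun_prop
  have hpolar := lintegral_radialProj_mul hn hp hH hw
  have hl := le_lintegral_pNorm_pow hn hp hp2 (m := 2 * k) (by omega)
  have hu := lintegral_inner_pow_le hp hθ hs0 hs k
  have hZ := integral_gaussWeight_pos hp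
  set Z := ∫ t, gaussWeight p t
  -- Homogeneity of degree `2k` separates the radius from the direction, as polar integration
  -- requires.
  have hlhs : ∀ x : Fin n → ℝ,
      ENNReal.ofReal ((∑ i, x i * θ i) ^ (2 * k) * Real.exp (-pNorm p x ^ p))
        = ENNReal.ofReal (pNorm p x ^ (2 * k) * Real.exp (-pNorm p x ^ p))
          * ENNReal.ofReal ((∑ i, radialProj p x i * θ i) ^ (2 * k)) := fun x => by
    have h0 := pNorm_nonneg p x
    rw [← ENNReal.ofReal_mul (by positivity)]
    congr 1
    conv_lhs => rw [← smul_radialProj hp x]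
    have h1 : ∑ i, (pNorm p x • radialProj p x) i * θ i
        = pNorm p x * ∑ i, radialProj p x i * θ i := by
      rw [Finset.mul_sum]
      exact Finset.sum_congr rfl fun i _ => by simp [mul_assoc]
    rw [h1, smul_radialProj hp]
    ring
  simp_rw [hlhs] at hu
  rw [hpolar] at hu
  set M := ∫⁻ x, ENNReal.ofReal ((∑ i, (x : Fin n → ℝ) i * θ i) ^ (2 * k)) ∂coneMeasure n p hp
  set B : ℝ := (n * Real.exp (-7)) ^ ((2 * k : ℕ) / p) * Z ^ n with hB
  have hB0 : 0 < B := by positivity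
  have h : M * ENNReal.ofReal B ≤ _ := (mul_le_mul_right hl M).trans hu
  rw [← ENNReal.le_div_iff_mul_le (Or.inl (by simpa using hB0)) (Or.inl ENNReal.ofReal_ne_top),
    ← ENNReal.ofReal_div_of_pos hB0] at h
  refine h.trans (ENNReal.ofReal_le_ofReal (le_of_eq ?_))
  rw [hB]
  field_simp


/-! ### Subgaussian moment growth under the cone measure -/

/-- The constant in the moment bound for linear forms. -/
noncomputable def momentConst : ℝ := 128 * Real.exp 33

theorem one_le_momentConst : 1 ≤ momentConst := by
  have := Real.one_le_exp (by norm_num : (0 : ℝ) ≤ 33)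
  unfold momentConst
  linarith

theorem normalization_pow {n : ℕ} (hn : 1 ≤ n) (p : ℝ) (k : ℕ) :
    (1 / (n : ℝ) ^ (1 / 2 - 1 / p)) ^ (2 * k) = (n : ℝ) ^ ((2 * k : ℕ) / p) / (n : ℝ) ^ k := by
  have hn0 : (0 : ℝ) < n := by exact_mod_cast hn
  rw [one_div, ← Real.rpow_neg hn0.le, ← Real.rpow_natCast, ← Real.rpow_mul hn0.le,
    ← Real.rpow_natCast (n : ℝ) k, ← Real.rpow_sub hn0]
  congr 1
  push_cast
  ring

theorem lintegral_pow_le_of_le {n : ℕ} {p : ℝ} (hp : 1 ≤ p) (hp2 : p ≤ 2)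
    {θ : Fin n → ℝ} (hθ : ∀ i, |θ i| ≤ 1) {k : ℕ} (hk : 1 ≤ k) (hkn : k ≤ n) :
    ∫⁻ x, ENNReal.ofReal ((1 / (n : ℝ) ^ (1 / 2 - 1 / p) *
        ∑ i, (x : Fin n → ℝ) i * θ i) ^ (2 * k)) ∂coneMeasure n p hp
      ≤ ENNReal.ofReal ((momentConst * k) ^ k) := by
  have hn : 1 ≤ n := hk.trans hkn
  have hn0 : (0 : ℝ) < n := by exact_mod_cast hn
  have hk0 : (0 : ℝ) < k := by exact_mod_cast hk
  have hkn' : (k : ℝ) ≤ n := by exact_mod_cast hkn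
  -- Up to constants, `s² = k/n` minimises `s^{-2k} e^{300 s² n}`; the `16` makes `s ≤ 1/4`
  -- equivalent to `k ≤ n`.
  set s : ℝ := √(k / (16 * n)) with hs_def
  have hs2 : s ^ 2 = k / (16 * n) := Real.sq_sqrt (by positivity)
  have hs0 : 0 < s := Real.sqrt_pos.2 (by positivity)
  have hs : s ≤ 1 / 4 := by
    refine Real.sqrt_le_iff.2 ⟨by norm_num, ?_⟩
    rw [div_le_iff₀ (by positivity)]
    linarith
  have hA : 0 ≤ (1 / (n : ℝ) ^ (1 / 2 - 1 / p)) ^ (2 * k) := by positivity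
  simp_rw [mul_pow, ENNReal.ofReal_mul hA]
  rw [← mul_pow momentConst, lintegral_const_mul' _ _ ENNReal.ofReal_ne_top]
  refine (mul_le_mul_right (lintegral_coneMeasure_mul_le hn hp hp2 hθ hs0 hs hk) _).trans ?_
  rw [← ENNReal.ofReal_mul hA]
  refine ENNReal.ofReal_le_ofReal ?_
  rw [normalization_pow hn, pow_mul s, hs2]
  set N : ℝ := (n : ℝ) ^ ((2 * k : ℕ) / p) with hN_def
  have hN : 0 < N := Real.rpow_pos_of_pos hn0 _
  have hfac : ((2 * k).factorial : ℝ) ≤ (4 * k * k) ^ k := by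
    have h : ((2 * k).factorial : ℝ) ≤ ((2 * k : ℕ) : ℝ) ^ (2 * k) := by
      exact_mod_cast Nat.factorial_le_pow (2 * k)
    refine h.trans (le_of_eq ?_)
    rw [pow_mul]
    congr 1
    push_cast
    ring
  -- Here `300/16 ≤ 19`, and the prefactor `2 ≤ 2^k` is absorbed because `k ≥ 1`.
  have hexp : 2 * Real.exp (300 * (k / (16 * n)) * n) ≤ (2 * Real.exp 19) ^ k := by
    rw [mul_pow, ← Real.exp_nat_mul]
    have h2 : (2 : ℝ) ≤ 2 ^ k := le_self_pow₀ one_le_two (by omega)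
    have h3 : 300 * ((k : ℝ) / (16 * n)) * n ≤ k * 19 := by
      have : 300 * ((k : ℝ) / (16 * n)) * n = 300 / 16 * k := by
        field_simp
      rw [this]
      linarith
    gcongr
  -- The `14` is `2 · 7`, as `p ≥ 1` gives `2k/p ≤ 2k`. The power `N` of `n` cancels against the
  -- normalisation.
  have hden : N * Real.exp (-14) ^ k ≤ (n * Real.exp (-7)) ^ ((2 * k : ℕ) / p) := by
    rw [Real.mul_rpow hn0.le (Real.exp_pos _).le, ← hN_def, ← Real.exp_mul, ← Real.exp_nat_mul]
    refine mul_le_mul_of_nonneg_left (Real.exp_le_exp.2 ?_) hN.le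
    have : ((2 * k : ℕ) : ℝ) / p ≤ (2 * k : ℕ) := div_le_self (Nat.cast_nonneg _) hp
    push_cast at this ⊢
    linarith
  calc N / (n : ℝ) ^ k * ((2 * k).factorial / (k / (16 * n)) ^ k *
        (2 * Real.exp (300 * (k / (16 * n)) * n)) / (n * Real.exp (-7)) ^ ((2 * k : ℕ) / p))
      ≤ N / (n : ℝ) ^ k * ((4 * k * k) ^ k / (k / (16 * n)) ^ k *
        (2 * Real.exp 19) ^ k / (N * Real.exp (-14) ^ k)) := by gcongr
    _ = (1 / (n : ℝ) ^ k * ((4 * k * k) ^ k / (k / (16 * n)) ^ k *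
        (2 * Real.exp 19) ^ k / (Real.exp (-14) ^ k))) := by
        field_simp
    _ = (1 / n * (4 * k * k / (k / (16 * n)) * (2 * Real.exp 19) / Real.exp (-14))) ^ k := by
        simp only [mul_pow, div_pow, one_pow]
    _ = (momentConst * k) ^ k := by
        -- Collecting constants: `4 · 16 · 2 = 128` and `e^{19+14} = e^{33}`.
        congr 1
        rw [momentConst, show (33 : ℝ) = 19 + 14 by norm_num, Real.exp_add, Real.exp_neg]
        field_simp
        norm_num

theorem coneMeasure_univ_le {n : ℕ} (hn : 1 ≤ n) {p : ℝ} (hp : 1 ≤ p) :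
    coneMeasure n p hp univ ≤ 1 := by
  have h := map_coneMeasure_apply hn hp MeasurableSet.univ
  rw [Measure.map_apply measurable_subtype_coe MeasurableSet.univ] at h
  simp only [preimage_univ, univ_inter] at h
  rw [h]
  exact ENNReal.div_self_le_one

/-- By Hölder, `|⟨x,θ⟩| ≤ ‖x‖_1 ≤ n^{1-1/p}` on the sphere, and the normalisation leaves `n^{1/2}`.
-/
theorem sq_normalized_inner_le {n : ℕ} (hn : 1 ≤ n) {p : ℝ} (hp : 1 ≤ p) {θ : Fin n → ℝ}
    (hθ : ∀ i, |θ i| ≤ 1) {x : Fin n → ℝ} (hx : x ∈ pSphere n p) :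
    (1 / (n : ℝ) ^ (1 / 2 - 1 / p) * ∑ i, x i * θ i) ^ 2 ≤ n := by
  have hn0 : (0 : ℝ) < n := by exact_mod_cast hn
  have hp0 : 0 < p := by linarith
  have hsum : |∑ i, x i * θ i| ≤ ∑ i, |x i| := by
    refine (Finset.abs_sum_le_sum_abs _ _).trans (Finset.sum_le_sum fun i _ => ?_)
    rw [abs_mul]
    exact mul_le_of_le_one_right (abs_nonneg _) (hθ i)
  have hnorm : ∑ i, |x i| ≤ (n : ℝ) ^ (1 - 1 / p) := by
    have h := Real.rpow_sum_le_const_mul_sum_rpow Finset.univ x hp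
    have hx1 : pNorm p x = 1 := hx
    rw [← pNorm_rpow hp, hx1, Real.one_rpow, mul_one, Finset.card_univ, Fintype.card_fin] at h
    refine (Real.rpow_le_rpow_iff (Finset.sum_nonneg fun i _ => abs_nonneg _)
      (by positivity) hp0).1 (h.trans (le_of_eq ?_))
    rw [← Real.rpow_mul hn0.le]
    congr 1
    field_simp
  have hA := normalization_pow hn p 1
  rw [mul_pow, show (1 / (n : ℝ) ^ (1 / 2 - 1 / p)) ^ 2 = _ from hA, ← sq_abs (∑ i, x i * θ i)]
  calc (n : ℝ) ^ ((2 * 1 : ℕ) / p) / (n : ℝ) ^ 1 * |∑ i, x i * θ i| ^ 2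
      ≤ (n : ℝ) ^ ((2 * 1 : ℕ) / p) / (n : ℝ) ^ 1 * ((n : ℝ) ^ (1 - 1 / p)) ^ 2 := by
        gcongr
        exact hsum.trans hnorm
    _ = (n : ℝ) := by
        rw [pow_one, ← Real.rpow_natCast ((n : ℝ) ^ (1 - 1 / p)), ← Real.rpow_mul hn0.le,
          div_mul_eq_mul_div, ← Real.rpow_add hn0, div_eq_iff hn0.ne',
          show (n : ℝ) * n = (n : ℝ) ^ (2 : ℝ) by rw [Real.rpow_two, sq]]
        congr 1
        push_cast
        field_simp
        ring

/-- Subgaussian growth of all even moments of normalised linear forms. -/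
theorem lintegral_pow_le {n : ℕ} (hn : 1 ≤ n) {p : ℝ} (hp : 1 ≤ p) (hp2 : p ≤ 2)
    {θ : Fin n → ℝ} (hθ : ∀ i, |θ i| ≤ 1) {k : ℕ} (hk : 1 ≤ k) :
    ∫⁻ x, ENNReal.ofReal ((1 / (n : ℝ) ^ (1 / 2 - 1 / p) *
        ∑ i, (x : Fin n → ℝ) i * θ i) ^ (2 * k)) ∂coneMeasure n p hp
      ≤ ENNReal.ofReal ((momentConst * k) ^ k) := by
  rcases le_total k n with hkn | hkn
  · exact lintegral_pow_le_of_le hp hp2 hθ hk hkn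
  · calc _ ≤ ∫⁻ _, ENNReal.ofReal ((momentConst * k) ^ k) ∂coneMeasure n p hp := by
          refine lintegral_mono fun x => ENNReal.ofReal_le_ofReal ?_
          rw [pow_mul]
          refine pow_le_pow_left₀ (sq_nonneg _) ?_ k
          have h1 : (n : ℝ) ≤ k := by exact_mod_cast hkn
          exact ((sq_normalized_inner_le hn hp hθ x.2).trans h1).trans
            (le_mul_of_one_le_left (Nat.cast_nonneg k) one_le_momentConst)
      _ ≤ _ := by
          rw [lintegral_const]
          exact mul_le_of_le_one_right' (coneMeasure_univ_le hn hp)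

/-! ### From moment growth to the `ψ₂` norm -/

theorem psi2_eq_tsum (y : ℝ) :
    ENNReal.ofReal (psi2 y)
      = ∑' k : ℕ, ENNReal.ofReal (y ^ (2 * (k + 1)) / (k + 1).factorial) := by
  have hs : HasSum (fun k : ℕ => (y ^ 2) ^ k / k.factorial) (Real.exp (y ^ 2)) := by
    rw [Real.exp_eq_exp_ℝ]
    exact NormedSpace.expSeries_div_hasSum_exp (y ^ 2)
  have hs1 := (hasSum_nat_add_iff' 1).2 hs
  simp only [Finset.sum_range_one, Nat.factorial_zero, Nat.cast_one, div_one, ← pow_mul,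
    mul_zero, pow_zero] at hs1
  rw [psi2, ← hs1.tsum_eq, ENNReal.ofReal_tsum_of_nonneg _ hs1.summable]
  exact fun k => div_nonneg ((even_two_mul _).pow_nonneg _) (Nat.cast_nonneg _)

/-- A function whose even moments grow like those of a Gaussian has finite `ψ₂` norm. -/
theorem lintegral_psi2_le_one {Ω : Type*} [MeasurableSpace Ω] {μ : Measure Ω} {f : Ω → ℝ}
    (hf : Measurable f) {D t : ℝ} (hD : 0 < D) (ht : t ^ 2 = 2 * D * Real.exp 1)
    (hmom : ∀ k : ℕ, 1 ≤ k →
      ∫⁻ ω, ENNReal.ofReal (f ω ^ (2 * k)) ∂μ ≤ ENNReal.ofReal ((D * k) ^ k)) :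
    ∫⁻ ω, ENNReal.ofReal (psi2 (|f ω| / t)) ∂μ ≤ 1 := by
  simp_rw [psi2_eq_tsum]
  rw [lintegral_tsum fun k => by fun_prop]
  have hterm : ∀ k : ℕ,
      ∫⁻ ω, ENNReal.ofReal ((|f ω| / t) ^ (2 * (k + 1)) / (k + 1).factorial) ∂μ
        ≤ ENNReal.ofReal ((1 / 2) ^ (k + 1)) := fun k => by
    have hF : (0 : ℝ) < (k + 1).factorial := by exact_mod_cast Nat.factorial_pos _
    have ht2 : 0 < t ^ 2 := by rw [ht]; positivity
    have hc : 0 ≤ ((t ^ 2) ^ (k + 1) * (k + 1).factorial)⁻¹ := by positivity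
    have hpt : ∀ ω, (|f ω| / t) ^ (2 * (k + 1)) / (k + 1).factorial
        = ((t ^ 2) ^ (k + 1) * (k + 1).factorial)⁻¹ * f ω ^ (2 * (k + 1)) := fun ω => by
      rw [div_pow, (even_two_mul (k + 1)).pow_abs, pow_mul t]
      field_simp
    simp_rw [hpt, ENNReal.ofReal_mul hc]
    rw [lintegral_const_mul' _ _ ENNReal.ofReal_ne_top]
    refine (mul_le_mul_right (hmom (k + 1) (by omega)) _).trans ?_
    rw [← ENNReal.ofReal_mul hc]
    refine ENNReal.ofReal_le_ofReal ?_
    -- This is `j^j ≤ e^j j!` with `j = k + 1`. The choice `t² = 2De` then leaves `2^{-j}` for the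
    -- `j`-th term.
    have h := Real.pow_div_factorial_le_exp ((k + 1 : ℕ) : ℝ) (Nat.cast_nonneg _) (k + 1)
    rw [div_le_iff₀ hF, ← mul_one (((k + 1 : ℕ) : ℝ)), Real.exp_nat_mul, mul_one] at h
    rw [inv_mul_le_iff₀ (by positivity), ht]
    calc (D * (k + 1 : ℕ)) ^ (k + 1) = D ^ (k + 1) * ((k + 1 : ℕ) : ℝ) ^ (k + 1) := mul_pow _ _ _
      _ ≤ D ^ (k + 1) * (Real.exp 1 ^ (k + 1) * (k + 1).factorial) := by gcongr
      _ = (2 * D * Real.exp 1) ^ (k + 1) * (k + 1).factorial * (1 / 2) ^ (k + 1) := by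
          rw [mul_pow, mul_pow, one_div, inv_pow]
          field_simp
  refine (ENNReal.tsum_le_tsum hterm).trans ?_
  -- The `-1` in `ψ₂` removes the zeroth term, so the geometric series sums to exactly `1` instead
  -- of `2`.
  have hg := (hasSum_nat_add_iff' 1).2 hasSum_geometric_two
  rw [← ENNReal.ofReal_tsum_of_nonneg (fun k => by positivity) hg.summable, hg.tsum_eq]
  norm_num

end ConeMeasure

theorem mainTheorem3 :
    ∃ c : ℝ, 0 < c ∧
      ∀ (n : ℕ) (_ : 1 ≤ n) (p : ℝ) (hp : 1 ≤ p) (_ : p < 2)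
        (θ : Fin n → ℝ) (_ : ‖θ‖ = 1),
        ConeMeasure.luxemburgNorm ConeMeasure.psi2 (ConeMeasure.coneMeasure n p hp)
          (fun x : ConeMeasure.pSphere n p =>
            1 / (n : ℝ) ^ (1 / 2 - 1 / p) * ∑ i, (x : Fin n → ℝ) i * θ i)
          ≤ ENNReal.ofReal c := by
  have hD : 0 < ConeMeasure.momentConst := zero_lt_one.trans_le ConeMeasure.one_le_momentConst
  have hc : 0 < 2 * ConeMeasure.momentConst * Real.exp 1 := by positivity
  refine ⟨√(2 * ConeMeasure.momentConst * Real.exp 1), Real.sqrt_pos.2 hc, ?_⟩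
  intro n hn p hp hp2 θ hθ
  refine sInf_le ⟨_, Real.sqrt_pos.2 hc, rfl, ?_⟩
  refine ConeMeasure.lintegral_psi2_le_one ?_ hD (Real.sq_sqrt hc.le) fun k hk => ?_
  · exact (by fun_prop : Measurable fun x : Fin n → ℝ =>
      1 / (n : ℝ) ^ (1 / 2 - 1 / p) * ∑ i, x i * θ i).comp measurable_subtype_coe
  · exact ConeMeasure.lintegral_pow_le hn hp hp2.le
      (fun i => (norm_le_pi_norm θ i).trans hθ.le) hk
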